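/- Let $\|x\|$ denote the Euclidean norm on $\mathbb{R}^k$ and, for a real matrix $A$, let $\|A\|$ denote the operator norm with respect to the Euclidean norms; $e_1,\dots,e_n$ is the standard basis of $\mathbb{R}^n$, $M_{k\times n}$ is the space of real $k\times n$ matrices, and a matrix-valued function is continuous if all its entries are continuous. Call a pair $(c_0,d_0)$ of positive reals admissible if for every $n$ and every $A\in M_{n\times n}$ with $\|Ae_i\|=1$ for $1\le i\le n$ there is $\sigma\subset\{1,\dots,n\}$ with $|\sigma|\ge d_0 n\|A\|^{-2}$ such that $$\Big\|\sum_{j\in\sigma}a_jAe_j\Big\|\ge c_0\Big(\sum_{j\in\sigma}|a_j|^2\Big)^{1/2}\quad\text{for all scalars }(a_j)_{j\in\sigma}.$$ **Theorem.** (i) (Bourgain–Tzafriri) Admissible pairs exist. (ii) Let $(c_0,d_0)$ be any admissible pair. Let $A:\mathbb{R}\to M_{n\times n}$ be continuous and $\theta>0$ with $\|A(t)\|\le 1$ and $\|A(t)e_i\|\ge\theta$ for all $t\in\mathbb{R}$ and $1\le i\le n$. Then for any $\gamma\in(0,1)$ and any integer $0\le m\le\lceil (d_0/7)\,n\theta^2\rceil$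 there exist continuous $L:\mathbb{R}\to M_{m\times n}$ and $R:\mathbb{R}\to M_{n\times m}$ such that, for all $t\in\mathbb{R}$, $$L(t)A(t)R(t)=I_m\quad\text{and}\quad \|L(t)\|\,\|R(t)\|\le \frac{(\gamma c_0)^{-1}}{\theta}.$$ (iii) The order $n\theta^2$ of $m$ is optimal: for every $n$ and every $\theta\in(0,1]$ with $n\theta^2\ge 1$ there is a continuous $A:\mathbb{R}\to M_{n\times n}$ with $\|A(t)\|\le1$ and $\|A(t)e_i\|\ge\theta$ for all $t\in\mathbb{R}$ and $1\le i\le n$, such that whenever $LA(t)R=I_m$ for some $t\in\mathbb{R}$, $m\ge 0$, $L\in M_{m\times n}$ and $R\in M_{n\times m}$, one has $m<4n\theta^2$. -/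

import Mathlib

open scoped Matrix.Norms.L2Operator

/-- The `i`-th column `A eᵢ` of a real matrix, as a vector with the Euclidean norm. -/
noncomputable def euclideanColumn {k n : ℕ} (A : Matrix (Fin k) (Fin n) ℝ) (i : Fin n) :
    EuclideanSpace ℝ (Fin k) :=
  Matrix.toEuclideanLin A (EuclideanSpace.single i 1)

/-- `c₀` and `d₀` are admissible constants in the Bourgain-Tzafriri restricted invertibility
principle: they are positive, and every real square matrix `A` (of any size `n`) with columns of
Euclidean norm one has at least `d₀ n / ‖A‖²` columns, indexed by some `σ`, with
`‖∑_{j ∈ σ} aⱼ A eⱼ‖ ≥ c₀ (∑_{j ∈ σ} |aⱼ|²)^{1/2}` for all scalars `aⱼ`. Here `‖A‖` is the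
operator norm with respect to the Euclidean norm. -/
def IsRestrictedInvertibilityPair (c₀ d₀ : ℝ) : Prop :=
  0 < c₀ ∧ 0 < d₀ ∧
    ∀ (n : ℕ) (A : Matrix (Fin n) (Fin n) ℝ), (∀ i, ‖euclideanColumn A i‖ = 1) →
      ∃ σ : Finset (Fin n), d₀ * n / ‖A‖ ^ 2 ≤ (σ.card : ℝ) ∧
        ∀ a : Fin n → ℝ,
          c₀ * Real.sqrt (∑ j ∈ σ, |a j| ^ 2) ≤ ‖∑ j ∈ σ, a j • euclideanColumn A j‖

/-! (i) is proved by the barrier method. Columns are selected one at a time, the Gram matrix of the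
selected ones staying above a barrier `b`. With `Z` the frame operator of `σ` and `Q = -b (Z -
b)⁻¹`, a Schur complement shows that `x i` may be added as soon as `⟪x i, Q (x i)⟫ > b`. The
potential `∑ i, ⟪x i, Q (x i)⟫` starts at `n`; lowering the barrier slightly before each insertion
keeps the loss small, by averaging over `i` (`GramBound.exists_insert`).

For (ii), normalizing the columns of `A t` and applying restricted invertibility gives, for each
`t`, a large coordinate subspace on which the normalized matrix `B t` is bounded below by `c₀`.
These subspaces may jump with `t`. An isometric embedding `E` is therefore rotated to an embedding
`F` into the next subspace, with `F` orthogonal to `E` and `B F` orthogonal to `B E`; by Pythagoras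
neither norms nor lower bounds suffer. Each rotation ends with the full constant `c₀`, so losses do
not accumulate over infinitely many steps; `γ` pays only for the variation of `B` within one step.
The Moore-Penrose inverse then yields `L`.

For (iii), repeating each column `θ eᵢ` about `θ⁻²` times gives a contraction of rank of order `n
θ²`. -/

/-! ### Restricted invertibility by the barrier method -/

section Barrier

open scoped InnerProductSpace

variable {ι E : Type*} [NormedAddCommGroup E] [InnerProductSpace ℝ E]

/-- The operator `v ↦ ∑ i ∈ σ, ⟪x i, v⟫ x i`. -/
noncomputable def frameOperator (x : ι → E) (σ : Finset ι) : E →ₗ[ℝ] E :=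
  ∑ i ∈ σ, (innerₗ E (x i)).smulRight (x i)

theorem frameOperator_apply (x : ι → E) (σ : Finset ι) (v : E) :
    frameOperator x σ v = ∑ i ∈ σ, ⟪x i, v⟫_ℝ • x i := by
  simp [frameOperator, LinearMap.sum_apply]

theorem inner_frameOperator (x : ι → E) (σ : Finset ι) (u v : E) :
    ⟪u, frameOperator x σ v⟫_ℝ = ∑ i ∈ σ, ⟪x i, u⟫_ℝ * ⟪x i, v⟫_ℝ := by
  rw [frameOperator_apply, inner_sum]
  refine Finset.sum_congr rfl fun i _ => ?_
  rw [inner_smul_right, real_inner_comm u (x i), mul_comm]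

theorem inner_frameOperator_comm (x : ι → E) (σ : Finset ι) (u v : E) :
    ⟪u, frameOperator x σ v⟫_ℝ = ⟪v, frameOperator x σ u⟫_ℝ := by
  simp only [inner_frameOperator, mul_comm]

/-- The Gram matrix of the vectors `x i`, `i ∈ σ`, is at least `b`. -/
def GramBound (x : ι → E) (σ : Finset ι) (b : ℝ) : Prop :=
  ∀ a : ι → ℝ, b * ∑ i ∈ σ, a i ^ 2 ≤ ‖∑ i ∈ σ, a i • x i‖ ^ 2

theorem GramBound.mono {x : ι → E} {σ : Finset ι} {b b' : ℝ} (h : GramBound x σ b)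
    (hb : b' ≤ b) : GramBound x σ b' := fun a =>
  (mul_le_mul_of_nonneg_right hb (Finset.sum_nonneg fun _ _ => sq_nonneg _)).trans (h a)

/-- Coefficients `⟪x i, v⟫` turn the Gram bound into `Z² ≥ b Z`: the frame operator has no
eigenvalue strictly between `0` and `b`. -/
theorem GramBound.inner_frameOperator_le {x : ι → E} {σ : Finset ι} {b : ℝ}
    (h : GramBound x σ b) (v : E) :
    b * ⟪v, frameOperator x σ v⟫_ℝ ≤ ‖frameOperator x σ v‖ ^ 2 := by
  have := h fun i => ⟪x i, v⟫_ℝ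
  rw [inner_frameOperator, frameOperator_apply]
  simpa only [sq] using this

/-- `Q = -b (Z - b)⁻¹`, where `Z` is the frame operator. -/
def IsScaledResolvent (x : ι → E) (σ : Finset ι) (b : ℝ) (Q : E →ₗ[ℝ] E) : Prop :=
  ∀ v, frameOperator x σ (Q v) = b • (Q v - v)

theorem GramBound.eq_zero_of_frameOperator_eq {x : ι → E} {σ : Finset ι} {b b' : ℝ}
    (h : GramBound x σ b) (hb' : 0 < b') (hb : b' < b) {v : E}
    (hv : frameOperator x σ v = b' • v) : v = 0 := by
  have h1 := h.inner_frameOperator_le v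
  rw [hv, inner_smul_right, real_inner_self_eq_norm_sq, norm_smul, mul_pow, Real.norm_eq_abs,
    sq_abs] at h1
  have h2 : b' * (b - b') * ‖v‖ ^ 2 ≤ 0 := by nlinarith
  have h3 : 0 < b' * (b - b') := mul_pos hb' (sub_pos.2 hb)
  have h4 : ‖v‖ ^ 2 ≤ 0 := by
    by_contra hne
    exact absurd h2 (not_le.2 (mul_pos h3 (not_le.1 hne)))
  exact norm_eq_zero.1 (pow_eq_zero_iff two_ne_zero |>.1 (le_antisymm h4 (sq_nonneg _)))

theorem GramBound.exists_isScaledResolvent [FiniteDimensional ℝ E] {x : ι → E} {σ : Finset ι}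
    {b b' : ℝ} (h : GramBound x σ b) (hb' : 0 < b') (hb : b' < b) :
    ∃ Q, IsScaledResolvent x σ b' Q := by
  let T : E →ₗ[ℝ] E := frameOperator x σ - b' • LinearMap.id
  have hT : Function.Injective T := by
    rw [injective_iff_map_eq_zero]
    intro v hv
    refine h.eq_zero_of_frameOperator_eq hb' hb ?_
    simpa [T, sub_eq_zero] using hv
  let e := LinearEquiv.ofInjectiveEndo T hT
  refine ⟨(-b') • e.symm.toLinearMap, fun v => ?_⟩
  have h1 : T (e.symm v) = v := by
    exact e.apply_symm_apply v
  have h2 : frameOperator x σ (e.symm v) = v + b' • e.symm v := by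
    nth_rewrite 2 [← h1]
    simp [T]
  simp only [LinearMap.smul_apply, LinearEquiv.coe_coe, map_smul, h2]
  module

namespace IsScaledResolvent

variable {x : ι → E} {σ : Finset ι} {b b' : ℝ} {Q Q' : E →ₗ[ℝ] E}

theorem inner_comm (h : IsScaledResolvent x σ b Q) (hb : b ≠ 0) (u v : E) :
    ⟪u, Q v⟫_ℝ = ⟪v, Q u⟫_ℝ := by
  have h1 := inner_frameOperator_comm x σ (Q u) (Q v)
  rw [h v, h u, inner_smul_right, inner_smul_right] at h1
  have h2 := mul_left_cancel₀ hb h1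
  rw [inner_sub_right, inner_sub_right, real_inner_comm (Q u) (Q v)] at h2
  rw [real_inner_comm (Q v) u, real_inner_comm (Q u) v]
  linarith

theorem ne_zero (h : IsScaledResolvent x σ b Q) (hb : b ≠ 0) {v : E} (hv : v ≠ 0) : Q v ≠ 0 := by
  intro h0
  have := h v
  rw [h0, map_zero, zero_sub, eq_comm, smul_eq_zero] at this
  rcases this with h1 | h1
  · exact hb h1
  · exact hv (neg_eq_zero.1 h1)

/-- A scalar inequality in each eigenvalue of `Z`, proved without diagonalizing: the difference of
the two sides is a sum of two terms, each nonnegative by `Z² ≥ b Z`. It controls the cost of an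
insertion by the gain from lowering the barrier. -/
theorem norm_sq_le (h : IsScaledResolvent x σ b Q) (h' : IsScaledResolvent x σ b' Q')
    (hG : GramBound x σ b) (hb' : 0 < b') (hb : b' < b) (v : E) :
    ‖Q' v‖ ^ 2 ≤ ‖v‖ ^ 2 + b' / (b - b') * (⟪v, Q' v⟫_ℝ - ⟪v, Q v⟫_ℝ) := by
  have hb0 : 0 < b := hb'.trans hb
  have hd : 0 < b - b' := sub_pos.2 hb
  set Z := frameOperator x σ with hZ
  -- Here `w = (Z - b)⁻¹ (Z - b')⁻¹ v`, and below `u = (Z - b')⁻¹ v`.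
  set w : E := (b * b')⁻¹ • Q' (Q v) with hw
  have hq : Q v = (-b) • (Z w - b' • w) := by
    rw [hw, map_smul, h' (Q v)]
    match_scalars
    · field_simp
    · field_simp
      ring
  set u : E := Z w - b • w with hu
  have hv : v = Z u - b' • u := by
    have h1 := h v
    have h2 : v = Q v - b⁻¹ • Z (Q v) := by
      rw [h1, smul_smul, inv_mul_cancel₀ hb0.ne', one_smul]; abel
    rw [h2, hq, hu]
    simp only [map_smul, map_sub]
    match_scalars <;> field_simp
  have hp : Q' v = (-b') • u := by
    rw [← sub_eq_zero]
    refine hG.eq_zero_of_frameOperator_eq hb' hb ?_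
    rw [map_sub, h' v, map_smul]
    nth_rewrite 2 [hv]
    module
  have e1 : ⟪w, Z (Z w)⟫_ℝ = ⟪Z w, Z w⟫_ℝ := by
    rw [hZ, inner_frameOperator_comm]
  have k1 : 0 ≤ ‖Z u‖ ^ 2 - b' * ⟪u, Z u⟫_ℝ := by
    have := (hG.mono hb.le).inner_frameOperator_le u
    linarith
  have k2 : 0 ≤ ‖Z w‖ ^ 2 - b * ⟪w, Z w⟫_ℝ := by
    have := hG.inner_frameOperator_le w
    linarith
  have key : ‖v‖ ^ 2 + b' / (b - b') * (⟪v, Q' v⟫_ℝ - ⟪v, Q v⟫_ℝ) - ‖Q' v‖ ^ 2 =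
      (‖Z u‖ ^ 2 - b' * ⟪u, Z u⟫_ℝ) + b' * (b - b') * (‖Z w‖ ^ 2 - b * ⟪w, Z w⟫_ℝ) := by
    have hqp : Q' v - Q v = (b - b') • Z w := by
      rw [hp, hq, hu]; module
    rw [← inner_sub_right, hqp, hp, hv]
    rw [hu]
    simp only [← real_inner_self_eq_norm_sq, map_sub, map_smul, inner_sub_left, inner_sub_right,
      inner_smul_left, inner_smul_right, RCLike.conj_to_real]
    rw [real_inner_comm w (Z (Z w)), real_inner_comm w (Z w), real_inner_comm (Z w) (Z (Z w)), e1]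
    field_simp
    ring
  nlinarith [mul_nonneg (mul_pos hb' hd).le k2]

/-- Completing the square in the Gram form after appending the vector `v`. -/
theorem norm_sum_add_sq (h : IsScaledResolvent x σ b Q) (hb : b ≠ 0) (a : ι → ℝ) (c : ℝ) (v : E) :
    ‖∑ i ∈ σ, a i • x i + c • v‖ ^ 2 - b * (∑ i ∈ σ, a i ^ 2 + c ^ 2) =
      ‖∑ i ∈ σ, (a i - c * (b⁻¹ * ⟪x i, Q v⟫_ℝ)) • x i‖ ^ 2
        - b * ∑ i ∈ σ, (a i - c * (b⁻¹ * ⟪x i, Q v⟫_ℝ)) ^ 2 + c ^ 2 * (⟪v, Q v⟫_ℝ - b) := by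
  set a' : ι → ℝ := fun i => a i - c * (b⁻¹ * ⟪x i, Q v⟫_ℝ) with ha'
  change _ = ‖∑ i ∈ σ, a' i • x i‖ ^ 2 - b * ∑ i ∈ σ, a' i ^ 2 + _
  have hZ := h v
  have hZ' : b⁻¹ • frameOperator x σ (Q v) = Q v - v := by
    rw [hZ, smul_smul, inv_mul_cancel₀ hb, one_smul]
  have h1 : ∑ i ∈ σ, a i • x i + c • v = ∑ i ∈ σ, a' i • x i + c • Q v := by
    have : ∑ i ∈ σ, a' i • x i = ∑ i ∈ σ, a i • x i - c • b⁻¹ • frameOperator x σ (Q v) := by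
      rw [frameOperator_apply, Finset.smul_sum, Finset.smul_sum, ← Finset.sum_sub_distrib]
      refine Finset.sum_congr rfl fun i _ => ?_
      rw [ha']; module
    rw [this, hZ']; module
  have h2 : ∑ i ∈ σ, a i ^ 2 = ∑ i ∈ σ, a' i ^ 2 +
      2 * c * b⁻¹ * ⟪∑ i ∈ σ, a' i • x i, Q v⟫_ℝ +
        c ^ 2 * (b⁻¹) ^ 2 * ⟪Q v, frameOperator x σ (Q v)⟫_ℝ := by
    rw [inner_frameOperator, sum_inner, Finset.mul_sum, Finset.mul_sum, ← Finset.sum_add_distrib,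
      ← Finset.sum_add_distrib]
    refine Finset.sum_congr rfl fun i _ => ?_
    rw [inner_smul_left, RCLike.conj_to_real]
    simp only [ha']; ring
  rw [hZ, inner_smul_right, inner_sub_right] at h2
  rw [h1, h2, norm_add_sq_real, inner_smul_right, norm_smul, mul_pow, Real.norm_eq_abs, sq_abs,
    ← real_inner_self_eq_norm_sq (Q v), real_inner_comm v (Q v)]
  field_simp
  ring

variable [DecidableEq ι]

theorem notMem_of_lt (h : IsScaledResolvent x σ b Q) (hb : 0 < b) (hG : GramBound x σ b) {i : ι}
    (hi : b < ⟪x i, Q (x i)⟫_ℝ) : i ∉ σ := by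
  intro hmem
  -- If `i ∈ σ`, coefficient `-1` at `i` cancels the appended `x i`: the left side becomes `-2b <
  -- 0`, the right side is positive.
  have h1 := h.norm_sum_add_sq hb.ne' (fun j => if j = i then -1 else 0) 1 (x i)
  have h2 := hG fun j => (if j = i then -1 else 0) - 1 * (b⁻¹ * ⟪x j, Q (x i)⟫_ℝ)
  have h3 : ∑ j ∈ σ, (if j = i then (-1 : ℝ) else 0) • x j = - x i := by
    simp [hmem]
  have h4 : ∑ j ∈ σ, (if j = i then (-1 : ℝ) else 0) ^ 2 = 1 := by
    simp [hmem]
  simp only [h3, h4, one_smul, neg_add_cancel, norm_zero] at h1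
  nlinarith

theorem gramBound_insert (h : IsScaledResolvent x σ b Q) (hb : 0 < b) (hG : GramBound x σ b)
    {i : ι} (hi : b < ⟪x i, Q (x i)⟫_ℝ) : GramBound x (insert i σ) b := by
  intro a
  have hmem := h.notMem_of_lt hb hG hi
  rw [Finset.sum_insert hmem, Finset.sum_insert hmem, add_comm (a i ^ 2), add_comm (a i • x i)]
  have h1 := h.norm_sum_add_sq hb.ne' a (a i) (x i)
  have h2 := hG fun j => a j - a i * (b⁻¹ * ⟪x j, Q (x i)⟫_ℝ)
  nlinarith [mul_nonneg (sq_nonneg (a i)) (sub_pos.2 hi).le]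

/-- The Sherman-Morrison formula for a rank-one update. -/
theorem insert (h : IsScaledResolvent x σ b Q) (hb : b ≠ 0) {i : ι} (hmem : i ∉ σ)
    (hi : b < ⟪x i, Q (x i)⟫_ℝ) :
    IsScaledResolvent x (insert i σ) b
      (Q - (⟪x i, Q (x i)⟫_ℝ - b)⁻¹ • (innerₗ E (Q (x i))).smulRight (Q (x i))) := by
  intro v
  have hs : ⟪x i, Q (x i)⟫_ℝ - b ≠ 0 := (sub_pos.2 hi).ne'
  have hZ : ∀ u, frameOperator x (Insert.insert i σ) u = ⟪x i, u⟫_ℝ • x i + frameOperator x σ u := by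
    intro u
    rw [frameOperator_apply, frameOperator_apply, Finset.sum_insert hmem]
  simp only [LinearMap.sub_apply, LinearMap.smul_apply, LinearMap.smulRight_apply, innerₗ_apply_apply,
    map_sub, map_smul, hZ, h v, h (x i), inner_sub_right, inner_smul_right]
  have hc : ⟪x i, Q v⟫_ℝ = ⟪Q (x i), v⟫_ℝ := by
    rw [h.inner_comm hb, real_inner_comm]
  rw [hc]
  match_scalars <;> field_simp
  ring

end IsScaledResolvent

/-- One step of the barrier method: a vector is added and the barrier is lowered by `δ`. -/
theorem GramBound.exists_insert [FiniteDimensional ℝ E] [Fintype ι] [DecidableEq ι] {x : ι → E}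
    (hx : ∀ i, ‖x i‖ = 1) {M : ℝ} (hM : 0 < M) (hxM : ∀ v, ∑ i, ⟪x i, v⟫_ℝ ^ 2 ≤ M * ‖v‖ ^ 2)
    {σ : Finset ι} {b δ : ℝ} (hδ : 0 < δ) (hb : 0 < b - δ) {Q : E →ₗ[ℝ] E}
    (hG : GramBound x σ b) (hQ : IsScaledResolvent x σ b Q) (hι : 0 < Fintype.card ι)
    (hM' : 2 * M * (b - δ) ≤ δ * Fintype.card ι)
    (hΨ : Fintype.card ι / 2 + Fintype.card ι * (b - δ) + δ * Fintype.card ι / (b - δ) ≤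
      ∑ i, ⟪x i, Q (x i)⟫_ℝ) :
    ∃ i ∉ σ, ∃ Q', GramBound x (insert i σ) (b - δ) ∧ IsScaledResolvent x (insert i σ) (b - δ) Q' ∧
      ∑ i, ⟪x i, Q (x i)⟫_ℝ - δ * Fintype.card ι / (b - δ) ≤ ∑ i, ⟪x i, Q' (x i)⟫_ℝ := by
  set n : ℝ := ((Fintype.card ι : ℕ) : ℝ) with hn
  have hn0 : 0 < n := Nat.cast_pos.2 hι
  set b' := b - δ with hb'
  have hlt : b' < b := by linarith
  obtain ⟨P, hP⟩ := hG.exists_isScaledResolvent hb hlt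
  have hG' := hG.mono hlt.le
  set T : ℝ := ∑ i, ‖P (x i)‖ ^ 2 with hT
  set ΨQ : ℝ := ∑ i, ⟪x i, Q (x i)⟫_ℝ with hΨQ
  set ΨP : ℝ := ∑ i, ⟪x i, P (x i)⟫_ℝ with hΨP
  have hT0 : 0 ≤ T := Finset.sum_nonneg fun _ _ => sq_nonneg _
  have hTle : T ≤ n + b' / δ * (ΨP - ΨQ) := by
    calc T ≤ ∑ i, (1 + b' / δ * (⟪x i, P (x i)⟫_ℝ - ⟪x i, Q (x i)⟫_ℝ)) := by
          refine Finset.sum_le_sum fun i _ => ?_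
          have := hQ.norm_sq_le hP hG hb hlt (x i)
          rw [hx i, one_pow] at this
          rwa [show b - b' = δ by simp [hb']] at this
      _ = n + b' / δ * (ΨP - ΨQ) := by
          rw [Finset.sum_add_distrib, ← Finset.mul_sum, Finset.sum_sub_distrib]
          simp [hn, hΨP, hΨQ]
  -- The permitted loss at insertion: what lowering the barrier gained, plus `δ n / b'`.
  set c : ℝ := ΨP - ΨQ + δ * n / b' with hc
  have hTc : δ / b' * T ≤ c := by
    have h1 := mul_le_mul_of_nonneg_left hTle (div_pos hδ hb).le
    have h2 : δ / b' * (n + b' / δ * (ΨP - ΨQ)) = c := by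
      rw [hc]; field_simp; ring
    linarith
  have hc0 : 0 ≤ c := (mul_nonneg (div_pos hδ hb).le hT0).trans hTc
  -- Averaging: a nonnegative sum provides an `i` whose insertion costs at most `M ‖P (x i)‖² / (⟪x
  -- i, P (x i)⟫ - b') ≤ c`.
  have hsum : 0 ≤ ∑ i, (c * (⟪x i, P (x i)⟫_ℝ - b') - M * ‖P (x i)‖ ^ 2) := by
    have h1 : ∑ i, (c * (⟪x i, P (x i)⟫_ℝ - b') - M * ‖P (x i)‖ ^ 2) =
        c * (ΨP - n * b') - M * T := by
      rw [Finset.sum_sub_distrib, ← Finset.mul_sum, ← Finset.mul_sum, Finset.sum_sub_distrib]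
      simp [hn]
      ring
    rw [h1]
    have h2 : n / 2 ≤ ΨP - n * b' := by linarith
    have h3 : M ≤ δ / b' * (n / 2) := by
      rw [div_mul_div_comm, le_div_iff₀ (by positivity)]
      linarith
    have h4 := mul_le_mul_of_nonneg_right h3 hT0
    have h5 := mul_le_mul hTc h2 (by positivity) hc0
    nlinarith
  obtain ⟨i, -, hi⟩ : ∃ i ∈ Finset.univ, 0 ≤ c * (⟪x i, P (x i)⟫_ℝ - b') - M * ‖P (x i)‖ ^ 2 := by
    have : Nonempty ι := Fintype.card_pos_iff.1 hι
    by_contra! hne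
    exact absurd hsum (not_le.2 (Finset.sum_neg (fun i hi => hne i hi) Finset.univ_nonempty))
  have hxi : x i ≠ 0 := by
    intro h0
    have := hx i
    rw [h0, norm_zero] at this
    exact zero_ne_one this
  have hPi : 0 < ‖P (x i)‖ ^ 2 := pow_pos (norm_pos_iff.2 (hP.ne_zero hb.ne' hxi)) 2
  have hs : 0 < ⟪x i, P (x i)⟫_ℝ - b' := by
    by_contra! hle
    nlinarith [mul_pos hM hPi, mul_nonneg hc0 (neg_nonneg.2 hle)]
  have hs' := sub_pos.1 hs
  have hmem := hP.notMem_of_lt hb hG' hs'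
  refine ⟨i, hmem, _, hP.gramBound_insert hb hG' hs', hP.insert hb.ne' hmem hs', ?_⟩
  have hloss : ∑ j, ⟪x j, (P - (⟪x i, P (x i)⟫_ℝ - b')⁻¹ •
      (innerₗ E (P (x i))).smulRight (P (x i))) (x j)⟫_ℝ =
      ΨP - (⟪x i, P (x i)⟫_ℝ - b')⁻¹ * ∑ j, ⟪x j, P (x i)⟫_ℝ ^ 2 := by
    rw [hΨP, Finset.mul_sum, ← Finset.sum_sub_distrib]
    refine Finset.sum_congr rfl fun j _ => ?_
    simp only [LinearMap.sub_apply, LinearMap.smul_apply, LinearMap.smulRight_apply,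
      innerₗ_apply_apply, inner_sub_right, inner_smul_right]
    rw [real_inner_comm (x j) (P (x i))]
    ring
  rw [hloss]
  have h1 : (⟪x i, P (x i)⟫_ℝ - b')⁻¹ * ∑ j, ⟪x j, P (x i)⟫_ℝ ^ 2 ≤ c := by
    rw [inv_mul_le_iff₀ hs]
    linarith [hxM (P (x i))]
  linarith

/-- The barrier starts at `1/4` and falls by `M / (2n)` per step, hence by at most `1/32` in all. It
stays above `1/8`, so each step costs at most `4M`, and the potential remains large enough while `16
M k ≤ n`. -/
theorem exists_gramBound_of_card_le [FiniteDimensional ℝ E] [Fintype ι] [DecidableEq ι]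
    {x : ι → E} (hx : ∀ i, ‖x i‖ = 1) {M : ℝ} (hM : 0 < M)
    (hxM : ∀ v, ∑ i, ⟪x i, v⟫_ℝ ^ 2 ≤ M * ‖v‖ ^ 2) (hι : 0 < Fintype.card ι) (k : ℕ)
    (hk : 16 * M * k ≤ Fintype.card ι) :
    ∃ σ : Finset ι, σ.card = k ∧ ∃ Q,
      GramBound x σ (1 / 4 - k * (M / (2 * Fintype.card ι))) ∧
      IsScaledResolvent x σ (1 / 4 - k * (M / (2 * Fintype.card ι))) Q ∧
      Fintype.card ι - 4 * M * k ≤ ∑ i, ⟪x i, Q (x i)⟫_ℝ := by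
  have hn0 : (0 : ℝ) < Fintype.card ι := Nat.cast_pos.2 hι
  induction k with
  | zero =>
    refine ⟨∅, rfl, LinearMap.id, fun a => by simp, fun v => by simp [frameOperator], ?_⟩
    simp [hx]
  | succ k ih =>
    push_cast at hk
    obtain ⟨σ, hσ, Q, hG, hQ, hΨ⟩ := ih (by nlinarith)
    set n : ℝ := ((Fintype.card ι : ℕ) : ℝ) with hn
    set δ : ℝ := M / (2 * n) with hδ
    have hδ0 : 0 < δ := by positivity
    have hb : 1 / 4 - k * δ - δ = 1 / 4 - (k + 1) * δ := by ring
    have hδn : δ * n = M / 2 := by rw [hδ]; field_simp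
    have hkδ : (k + 1) * δ ≤ 1 / 32 := by
      rw [hδ, ← mul_div_assoc, div_le_iff₀ (by positivity)]
      linarith
    have hk0 : (0 : ℝ) ≤ k := k.cast_nonneg
    have hb1 : 1 / 8 ≤ 1 / 4 - k * δ - δ := by linarith
    have hb2 : 1 / 4 - k * δ - δ ≤ 1 / 4 := by nlinarith
    have hΔ : δ * n / (1 / 4 - k * δ - δ) ≤ 4 * M := by
      rw [hδn, div_le_iff₀ (by linarith)]
      nlinarith
    obtain ⟨i, hi, Q', hG', hQ', hΨ'⟩ := hG.exists_insert hx hM hxM hδ0 (by linarith) hQ hι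
      (by rw [hδn]; nlinarith) (by
        have : n * (1 / 4 - k * δ - δ) ≤ n * (1 / 4) := mul_le_mul_of_nonneg_left hb2 hn0.le
        linarith)
    refine ⟨insert i σ, by rw [Finset.card_insert_of_notMem hi, hσ], Q', ?_, ?_, ?_⟩
    · push_cast; rwa [← hb]
    · push_cast; rwa [← hb]
    · push_cast; linarith

/-- Restricted invertibility for unit vectors with upper frame bound `M`. -/
theorem exists_gramBound [FiniteDimensional ℝ E] [Fintype ι] {x : ι → E} (hx : ∀ i, ‖x i‖ = 1)
    {M : ℝ} (hM : 0 < M) (hxM : ∀ v, ∑ i, ⟪x i, v⟫_ℝ ^ 2 ≤ M * ‖v‖ ^ 2) :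
    ∃ σ : Finset ι, 1 / 32 * Fintype.card ι / M ≤ σ.card ∧ GramBound x σ (1 / 9) := by
  classical
  rcases Nat.eq_zero_or_pos (Fintype.card ι) with h0 | hι
  · exact ⟨∅, by simp [h0], fun a => by simp⟩
  have hn0 : (0 : ℝ) < Fintype.card ι := Nat.cast_pos.2 hι
  set n : ℝ := ((Fintype.card ι : ℕ) : ℝ) with hn
  set y : ℝ := n / (16 * M) with hy
  have hy0 : 0 < y := by positivity
  have hy2 : 1 / 32 * n / M = y / 2 := by rw [hy]; field_simp; norm_num
  rw [hy2]
  -- For `y < 1` one vector is enough; for `y ≥ 1` rounding down costs at most a factor `2`.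
  rcases lt_or_ge y 1 with h1 | h1
  · obtain ⟨i⟩ : Nonempty ι := Fintype.card_pos_iff.1 hι
    refine ⟨{i}, by simp; linarith, fun a => ?_⟩
    simp only [Finset.sum_singleton, norm_smul, hx i, mul_one, Real.norm_eq_abs, sq_abs]
    nlinarith [sq_nonneg (a i)]
  · have hfl : (⌊y⌋₊ : ℝ) ≤ y := Nat.floor_le hy0.le
    have hfl' : y < ⌊y⌋₊ + 1 := Nat.lt_floor_add_one y
    have hfl1 : (1 : ℝ) ≤ ⌊y⌋₊ := by exact_mod_cast (Nat.one_le_floor_iff y).2 h1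
    have hkM : 16 * M * ⌊y⌋₊ ≤ n := by
      have := (le_div_iff₀ (by positivity)).1 (hfl.trans_eq hy)
      linarith
    obtain ⟨σ, hσ, Q, hG, -, -⟩ := exists_gramBound_of_card_le hx hM hxM hι ⌊y⌋₊ hkM
    refine ⟨σ, by rw [hσ]; linarith, hG.mono ?_⟩
    have : ⌊y⌋₊ * (M / (2 * n)) ≤ 1 / 32 := by
      rw [← mul_div_assoc, div_le_iff₀ (by positivity)]
      linarith
    linarith

end Barrier

/-! ### Columns of matrices and the existence of admissible pairs -/

theorem euclideanColumn_apply {k n : ℕ} (A : Matrix (Fin k) (Fin n) ℝ) (i : Fin n) (j : Fin k) :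
    euclideanColumn A i j = A j i := by
  simp [euclideanColumn, Matrix.toLpLin_apply]

theorem sum_inner_euclideanColumn_sq_le {k n : ℕ} (A : Matrix (Fin k) (Fin n) ℝ)
    (v : EuclideanSpace ℝ (Fin k)) :
    ∑ i, (inner ℝ (euclideanColumn A i) v) ^ 2 ≤ ‖A‖ ^ 2 * ‖v‖ ^ 2 := by
  have h := Matrix.l2_opNorm_mulVec A.conjTranspose v
  rw [Matrix.l2_opNorm_conjTranspose] at h
  have h2 := pow_le_pow_left₀ (norm_nonneg _) h 2
  rw [mul_pow, EuclideanSpace.norm_sq_eq] at h2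
  refine le_trans (le_of_eq (Finset.sum_congr rfl fun i _ => ?_)) h2
  rw [Real.norm_eq_abs, sq_abs]
  congr 1
  simp [PiLp.inner_apply, euclideanColumn_apply, Matrix.mulVec, dotProduct, mul_comm]

theorem exists_isRestrictedInvertibilityPair : ∃ c₀ d₀ : ℝ, IsRestrictedInvertibilityPair c₀ d₀ := by
  refine ⟨1 / 3, 1 / 32, by norm_num, by norm_num, fun n A hA => ?_⟩
  -- When `‖A‖ = 0` the quotient `d₀ n / ‖A‖²` is `0` by convention, and `∅` works.
  rcases (sq_nonneg ‖A‖).eq_or_lt with h0 | hpos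
  · exact ⟨∅, by simp [← h0], fun a => by simp⟩
  obtain ⟨σ, hσ, hG⟩ := exists_gramBound hA hpos (sum_inner_euclideanColumn_sq_le A)
  refine ⟨σ, by simpa using hσ, fun a => ?_⟩
  refine le_of_sq_le_sq ?_ (norm_nonneg _)
  rw [mul_pow, Real.sq_sqrt (Finset.sum_nonneg fun _ _ => sq_nonneg _)]
  refine le_trans (le_of_eq ?_) (hG a)
  simp only [sq_abs]
  norm_num

/-! ### Continuous paths of embeddings by rotation -/

theorem exists_linearIsometry_forall_mem {W V : Type*} [NormedAddCommGroup W]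
    [InnerProductSpace ℝ W] [FiniteDimensional ℝ W] [NormedAddCommGroup V] [InnerProductSpace ℝ V]
    [FiniteDimensional ℝ V] (U : Submodule ℝ V)
    (h : Module.finrank ℝ W ≤ Module.finrank ℝ U) : ∃ F : W →ₗᵢ[ℝ] V, ∀ w, F w ∈ U := by
  let b := stdOrthonormalBasis ℝ W
  let c := stdOrthonormalBasis ℝ U
  let f : W →ₗ[ℝ] V := b.toBasis.constr ℝ fun i => (c (Fin.castLE h i) : V)
  have hf : (f ∘ b.toBasis) = fun i => (c (Fin.castLE h i) : V) := by
    ext i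
    simp only [f, Function.comp_apply, Module.Basis.constr_basis]
  have ho : Orthonormal ℝ fun i => (c (Fin.castLE h i) : V) :=
    (c.orthonormal.comp_linearIsometry U.subtypeₗᵢ).comp _ (Fin.castLE_injective h)
  refine ⟨f.isometryOfOrthonormal (v := b.toBasis) (by simp [b.orthonormal])
    (by rw [hf]; exact ho), fun w => ?_⟩
  change f w ∈ U
  simp only [f, Module.Basis.constr_apply_fintype]
  exact U.sum_mem fun i _ => U.smul_mem _ (c _).2

theorem Submodule.finrank_le_finrank_inf_orthogonal_add {V : Type*} [NormedAddCommGroup V]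
    [InnerProductSpace ℝ V] [FiniteDimensional ℝ V] (S T : Submodule ℝ V) :
    Module.finrank ℝ S ≤ Module.finrank ℝ (S ⊓ Tᗮ : Submodule ℝ V) + Module.finrank ℝ T := by
  have h1 := Submodule.finrank_sup_add_finrank_inf_eq S Tᗮ
  have h2 := T.finrank_add_finrank_orthogonal
  have h3 := (S ⊔ Tᗮ).finrank_le
  omega

open ContinuousLinearMap in
/-- A subspace of three times the dimension contains an isometric copy of `W` orthogonal to a given
one, and with orthogonal image under `B`. -/
theorem exists_linearIsometry_orthogonal {W V V' : Type*} [NormedAddCommGroup W]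
    [InnerProductSpace ℝ W] [FiniteDimensional ℝ W] [NormedAddCommGroup V] [InnerProductSpace ℝ V]
    [FiniteDimensional ℝ V] [NormedAddCommGroup V'] [InnerProductSpace ℝ V']
    [FiniteDimensional ℝ V'] (B : V →L[ℝ] V') (E : W →L[ℝ] V) (S : Submodule ℝ V)
    (hS : 3 * Module.finrank ℝ W ≤ Module.finrank ℝ S) :
    ∃ F : W →ₗᵢ[ℝ] V, (∀ w, F w ∈ S) ∧ (∀ w w', inner ℝ (E w) (F w') = 0) ∧
      ∀ w w', inner ℝ (B (E w)) (B (F w')) = 0 := by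
  have : CompleteSpace V := FiniteDimensional.complete ℝ V
  have : CompleteSpace V' := FiniteDimensional.complete ℝ V'
  let T₁ : Submodule ℝ V := LinearMap.range E.toLinearMap
  let T₂ : Submodule ℝ V := LinearMap.range (adjoint B ∘L B ∘L E).toLinearMap
  have h1 : Module.finrank ℝ T₁ ≤ Module.finrank ℝ W := LinearMap.finrank_range_le _
  have h2 : Module.finrank ℝ T₂ ≤ Module.finrank ℝ W := LinearMap.finrank_range_le _
  -- Orthogonality to `T₁` and `T₂` costs at most `2 dim W` of the `3 dim W` dimensions.
  have h3 := S.finrank_le_finrank_inf_orthogonal_add (T₁ ⊔ T₂)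
  have h4 := Submodule.finrank_add_le_finrank_add_finrank T₁ T₂
  obtain ⟨F, hF⟩ := exists_linearIsometry_forall_mem (W := W) (S ⊓ (T₁ ⊔ T₂)ᗮ) (by omega)
  refine ⟨F, fun w => (hF w).1, fun w w' => ?_, fun w w' => ?_⟩
  · exact (Submodule.mem_orthogonal _ _).1 (hF w').2 _ (le_sup_left (b := T₂) ⟨w, rfl⟩)
  · have := (Submodule.mem_orthogonal _ _).1 (hF w').2 _ (le_sup_right (a := T₁) ⟨w, rfl⟩)
    simpa [adjoint_inner_left] using this

/-- If every short interval carries a path from any state at its left end to some state at its right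
end, then every state at `0` is the origin of a path over `[0, ∞)`. -/
theorem exists_continuous_of_local_paths {X : Type*} [TopologicalSpace X] (G H : ℝ → Set X)
    (hloc : ∀ T, ∃ δ > 0, ∀ u v, |u| ≤ T → |v| ≤ T → u < v → v - u ≤ δ → ∀ x ∈ G u,
      ∃ f : ℝ → X, Continuous f ∧ f u = x ∧ f v ∈ G v ∧ ∀ s ∈ Set.Icc u v, f s ∈ H s)
    {x : X} (hx : x ∈ G 0) :
    ∃ f : ℝ → X, Continuous f ∧ f 0 = x ∧ ∀ s, 0 ≤ s → f s ∈ H s := by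
  have hglue : ∀ {a b c : ℝ}, a ≤ b → b ≤ c → ∀ {f g : ℝ → X}, Continuous f → Continuous g →
      f b = g b → (∀ s ∈ Set.Icc a b, f s ∈ H s) → (∀ s ∈ Set.Icc b c, g s ∈ H s) →
      ∃ h : ℝ → X, Continuous h ∧ (∀ s ≤ b, h s = f s) ∧ h c = g c ∧
        ∀ s ∈ Set.Icc a c, h s ∈ H s := by
    intro a b c hab hbc f g hf hg hfg hfH hgH
    refine ⟨fun s => if s ≤ b then f s else g s,
      hf.if_le hg continuous_id continuous_const fun s hs => by rw [show s = b from hs, hfg],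
      fun s hs => if_pos hs, ?_, fun s hs => ?_⟩
    · rcases hbc.eq_or_lt with rfl | hlt
      · simp [hfg]
      · simp [not_le.2 hlt]
    · by_cases h : s ≤ b
      · simpa [h] using hfH s ⟨hs.1, h⟩
      · simpa [h] using hgH s ⟨(not_le.1 h).le, hs.2⟩
  have hinterval : ∀ a b, a < b → ∀ y ∈ G a,
      ∃ f : ℝ → X, Continuous f ∧ f a = y ∧ f b ∈ G b ∧ ∀ s ∈ Set.Icc a b, f s ∈ H s := by
    intro a b hab y hy
    obtain ⟨δ, hδ, hstep⟩ := hloc (max |a| |b|)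
    have habs : ∀ v ∈ Set.Icc a b, |v| ≤ max |a| |b| := fun v hv =>
      abs_le_max_abs_abs hv.1 hv.2
    have main : ∀ N : ℕ, ∀ v, a < v → v ≤ b → v - a ≤ (N + 1 : ℕ) * δ →
        ∃ f : ℝ → X, Continuous f ∧ f a = y ∧ f v ∈ G v ∧ ∀ s ∈ Set.Icc a v, f s ∈ H s := by
      intro N
      induction N with
      | zero =>
        intro v hav hvb hN
        exact hstep a v (habs a ⟨le_rfl, hab.le⟩) (habs v ⟨hav.le, hvb⟩) hav (by simpa using hN) y hy
      | succ N ih =>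
        intro v hav hvb hN
        by_cases hsmall : v - a ≤ (N + 1 : ℕ) * δ
        · exact ih v hav hvb hsmall
        push Not at hsmall
        have hN0 : 0 < ((N + 1 : ℕ) : ℝ) * δ := by positivity
        set u := a + (N + 1 : ℕ) * δ with hu
        have hau : a < u := by linarith
        have huv : u < v := by linarith
        obtain ⟨f, hf, hfa, hfu, hfH⟩ := ih u hau (huv.le.trans hvb) (by linarith)
        obtain ⟨g, hg, hgu, hgv, hgH⟩ := hstep u v (habs u ⟨hau.le, huv.le.trans hvb⟩)
          (habs v ⟨hav.le, hvb⟩) huv (by push_cast at hN hu; linarith) (f u) hfu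
        obtain ⟨h, hh, hhf, hhg, hhH⟩ := hglue hau.le huv.le hf hg hgu.symm hfH hgH
        exact ⟨h, hh, by rw [hhf a hau.le, hfa], by rwa [hhg], hhH⟩
    obtain ⟨N, hN⟩ := exists_nat_ge ((b - a) / δ)
    refine main N b hab le_rfl ?_
    rw [div_le_iff₀ hδ] at hN
    push_cast
    linarith
  have hstep : ∀ (k : ℕ) (p : {f : ℝ → X // Continuous f ∧ f k ∈ G k ∧
      ∀ s ∈ Set.Icc 0 (k : ℝ), f s ∈ H s}),
      ∃ q : {f : ℝ → X // Continuous f ∧ f (k + 1 : ℕ) ∈ G (k + 1 : ℕ) ∧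
        ∀ s ∈ Set.Icc 0 ((k + 1 : ℕ) : ℝ), f s ∈ H s}, ∀ s ≤ (k : ℝ), q.1 s = p.1 s := by
    rintro k ⟨f, hf, hfk, hfH⟩
    have hk : (k : ℝ) < (k + 1 : ℕ) := by push_cast; linarith
    obtain ⟨g, hg, hgk, hgk', hgH⟩ := hinterval k (k + 1 : ℕ) hk (f k) hfk
    obtain ⟨h, hh, hhf, hhg, hhH⟩ := hglue k.cast_nonneg hk.le hf hg hgk.symm hfH hgH
    exact ⟨⟨h, hh, by rwa [hhg], hhH⟩, hhf⟩
  choose next hnext using hstep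
  obtain ⟨f₀, hf₀, hf₀x, hf₀1, hf₀H⟩ := hinterval 0 1 one_pos x hx
  -- The path `q k` is valid up to `k + 1`, so `q ⌈s⌉₊` is valid a full unit beyond `⌈s⌉₊`; this
  -- room gives continuity at integers.
  let q : ∀ k : ℕ, {f : ℝ → X // Continuous f ∧ f (k + 1 : ℕ) ∈ G (k + 1 : ℕ) ∧
      ∀ s ∈ Set.Icc 0 ((k + 1 : ℕ) : ℝ), f s ∈ H s} := fun k =>
    Nat.rec ⟨f₀, hf₀, by simpa using hf₀1, by simpa using hf₀H⟩ (fun k p => next (k + 1) p) k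
  have hq : ∀ k (s : ℝ), s ≤ (k + 1 : ℕ) → (q (k + 1)).1 s = (q k).1 s := fun k s hs =>
    hnext (k + 1) (q k) s hs
  have hqle : ∀ j k, j ≤ k → ∀ s : ℝ, s ≤ (j + 1 : ℕ) → (q k).1 s = (q j).1 s := by
    intro j k hjk s hs
    induction k, hjk using Nat.le_induction with
    | base => rfl
    | succ k hjk ih => rw [hq k s (hs.trans (by exact_mod_cast Nat.succ_le_succ hjk)), ih]
  have hceil : ∀ s : ℝ, s ≤ (⌈s⌉₊ + 1 : ℕ) := fun s => by
    push_cast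
    linarith [Nat.le_ceil s]
  refine ⟨fun s => (q ⌈s⌉₊).1 s, continuous_iff_continuousAt.2 fun s₀ => ?_, ?_, fun s hs => ?_⟩
  · have hlt : s₀ < (⌈s₀⌉₊ + 1 : ℕ) := by
      push_cast
      linarith [Nat.le_ceil s₀]
    refine (q (⌈s₀⌉₊ + 1)).2.1.continuousAt.congr ?_
    filter_upwards [Iio_mem_nhds hlt] with s hs
    exact hqle _ _ (Nat.ceil_le.2 hs.le) s (hceil s)
  · exact (hqle 0 _ (Nat.zero_le _) 0 (by simp)).trans hf₀x
  · exact (q ⌈s⌉₊).2.2.2 s ⟨hs, hceil s⟩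

/-- A path of contractions `E t : W → V` along which `B t ∘ E t` is bounded below by almost `c`,
provided that each `B t` is bounded below by `c` on a large subspace. -/
theorem exists_continuous_forall_lowerBound {W V V' : Type*} [NormedAddCommGroup W]
    [InnerProductSpace ℝ W] [FiniteDimensional ℝ W] [NormedAddCommGroup V] [InnerProductSpace ℝ V]
    [FiniteDimensional ℝ V] [NormedAddCommGroup V'] [InnerProductSpace ℝ V']
    [FiniteDimensional ℝ V'] {B : ℝ → V →L[ℝ] V'} (hB : Continuous B) {c c' : ℝ} (hc' : 0 ≤ c')
    (hc : c' < c)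
    (hS : ∀ t, ∃ S : Submodule ℝ V, 3 * Module.finrank ℝ W ≤ Module.finrank ℝ S ∧
      ∀ v ∈ S, c * ‖v‖ ≤ ‖B t v‖) :
    ∃ E : ℝ → W →L[ℝ] V, Continuous E ∧ (∀ t, ‖E t‖ ≤ 1) ∧ ∀ t w, c' * ‖w‖ ≤ ‖B t (E t w)‖ := by
  have hray : ∀ B : ℝ → V →L[ℝ] V', Continuous B →
      (∀ t, ∃ S : Submodule ℝ V, 3 * Module.finrank ℝ W ≤ Module.finrank ℝ S ∧
        ∀ v ∈ S, c * ‖v‖ ≤ ‖B t v‖) →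
      ∀ E₀ : W →L[ℝ] V, (∀ w, ‖E₀ w‖ = ‖w‖) → (∀ w, c * ‖w‖ ≤ ‖B 0 (E₀ w)‖) →
      ∃ E : ℝ → W →L[ℝ] V, Continuous E ∧ E 0 = E₀ ∧
        ∀ t, 0 ≤ t → ‖E t‖ ≤ 1 ∧ ∀ w, c' * ‖w‖ ≤ ‖B t (E t w)‖ := by
    intro B hB hS E₀ hE₀ hE₀B
    refine exists_continuous_of_local_paths
      (fun t => {E : W →L[ℝ] V | (∀ w, ‖E w‖ = ‖w‖) ∧ ∀ w, c * ‖w‖ ≤ ‖B t (E w)‖})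
      (fun t => {E : W →L[ℝ] V | ‖E‖ ≤ 1 ∧ ∀ w, c' * ‖w‖ ≤ ‖B t (E w)‖})
      (fun T => ?_) ⟨hE₀, hE₀B⟩
    -- The margin is spent twice: in passing from `B u` to `B v` for `E`, and from `B v` back to `B
    -- s` for the rotated map.
    set η := (c - c') / 2 with hη
    have hη0 : 0 < η := by rw [hη]; linarith
    obtain ⟨δ, hδ, hunif⟩ := Metric.uniformContinuousOn_iff.1
      ((isCompact_Icc (a := -T) (b := T)).uniformContinuousOn_of_continuous hB.continuousOn) η hη0
    refine ⟨δ / 2, half_pos hδ, fun u v hu hv huv hvu E hE => ?_⟩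
    have hclose : ∀ s ∈ Set.Icc u v, ‖B s - B v‖ ≤ η := by
      intro s hs
      rw [← dist_eq_norm]
      refine (hunif s ⟨(abs_le.1 hu).1.trans hs.1, hs.2.trans (abs_le.1 hv).2⟩ v (abs_le.1 hv)
        ?_).le
      rw [Real.dist_eq, abs_sub_lt_iff]
      constructor <;> linarith [hs.1, hs.2]
    obtain ⟨S, hSdim, hSB⟩ := hS v
    obtain ⟨F, hFS, hEF, hBEF⟩ := exists_linearIsometry_orthogonal (B v) E S hSdim
    let φ : ℝ → ℝ := fun s => Real.pi / 2 * ((s - u) / (v - u))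
    have hφ : Continuous φ := by fun_prop
    have hφu : φ u = 0 := by simp [φ]
    have hφv : φ v = Real.pi / 2 := by simp [φ, (sub_pos.2 huv).ne']
    refine ⟨fun s => Real.cos (φ s) • E + Real.sin (φ s) • F.toContinuousLinearMap, by fun_prop,
      by simp [hφu], ?_, fun s hs => ?_⟩
    · simp only [hφv, Real.cos_pi_div_two, Real.sin_pi_div_two, zero_smul, one_smul, zero_add]
      exact ⟨F.norm_map, fun w => by simpa using hSB (F w) (hFS w)⟩
    set P := Real.cos (φ s) • E + Real.sin (φ s) • F.toContinuousLinearMap with hP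
    have hcs := Real.cos_sq_add_sin_sq (φ s)
    have hPw : ∀ w, P w = Real.cos (φ s) • E w + Real.sin (φ s) • F w := fun w => by simp [hP]
    have hnorm : ∀ w, ‖P w‖ = ‖w‖ := by
      intro w
      rw [← sq_eq_sq₀ (norm_nonneg _) (norm_nonneg _), hPw, norm_add_sq_real, inner_smul_left,
        inner_smul_right, hEF, norm_smul, norm_smul, hE.1, F.norm_map, mul_pow, mul_pow,
        Real.norm_eq_abs, Real.norm_eq_abs, sq_abs, sq_abs]
      linear_combination ‖w‖ ^ 2 * hcs
    have hη2 : 0 ≤ c - η := by rw [hη]; linarith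
    have hpert : ∀ s ∈ Set.Icc u v, ∀ y : V, ‖B s y‖ - η * ‖y‖ ≤ ‖B v y‖ ∧
        ‖B v y‖ - η * ‖y‖ ≤ ‖B s y‖ := by
      intro s hs y
      have h1 : ‖B s y - B v y‖ ≤ η * ‖y‖ :=
        ((B s - B v).le_opNorm y).trans (mul_le_mul_of_nonneg_right (hclose s hs) (norm_nonneg _))
      have h2 := abs_le.1 ((abs_norm_sub_norm_le (B s y) (B v y)).trans h1)
      constructor <;> linarith [h2.1, h2.2]
    have hE' : ∀ w, (c - η) * ‖w‖ ≤ ‖B v (E w)‖ := by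
      intro w
      have h1 := (hpert u ⟨le_rfl, huv.le⟩ (E w)).1
      rw [hE.1 w] at h1
      linarith [hE.2 w]
    have hF' : ∀ w, (c - η) * ‖w‖ ≤ ‖B v (F w)‖ := by
      intro w
      have h1 := hSB (F w) (hFS w)
      rw [F.norm_map] at h1
      nlinarith [norm_nonneg w]
    refine ⟨P.opNorm_le_bound zero_le_one fun w => by rw [hnorm w, one_mul], fun w => ?_⟩
    have hPv : (c - η) * ‖w‖ ≤ ‖B v (P w)‖ := by
      refine le_of_sq_le_sq ?_ (norm_nonneg _)
      have h0 : 0 ≤ (c - η) * ‖w‖ := mul_nonneg hη2 (norm_nonneg _)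
      have h1 := pow_le_pow_left₀ h0 (hE' w) 2
      have h2 := pow_le_pow_left₀ h0 (hF' w) 2
      rw [hPw, map_add, map_smul, map_smul, norm_add_sq_real, inner_smul_left, inner_smul_right,
        hBEF, norm_smul, norm_smul, mul_pow _ ‖B v (E w)‖, mul_pow _ ‖B v (F w)‖, Real.norm_eq_abs,
        Real.norm_eq_abs, sq_abs, sq_abs]
      have h3 := mul_le_mul_of_nonneg_left h1 (sq_nonneg (Real.cos (φ s)))
      have h4 := mul_le_mul_of_nonneg_left h2 (sq_nonneg (Real.sin (φ s)))
      calc ((c - η) * ‖w‖) ^ 2 = (Real.cos (φ s) ^ 2 + Real.sin (φ s) ^ 2) * ((c - η) * ‖w‖) ^ 2 := by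
            rw [hcs, one_mul]
        _ ≤ _ := by simp only [mul_zero, add_zero]; linarith
    have h5 := (hpert s hs (P w)).2
    rw [hnorm w] at h5
    have h6 : c' * ‖w‖ = (c - η) * ‖w‖ - η * ‖w‖ := by rw [hη]; ring
    linarith
  obtain ⟨S, hSdim, hSB⟩ := hS 0
  obtain ⟨F, hF⟩ := exists_linearIsometry_forall_mem (W := W) S (by omega)
  have hFB : ∀ w, c * ‖w‖ ≤ ‖B 0 (F.toContinuousLinearMap w)‖ := fun w => by
    simpa using hSB (F w) (hF w)
  obtain ⟨E₁, hE₁, hE₁0, hE₁H⟩ := hray B hB hS F.toContinuousLinearMap F.norm_map hFB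
  -- The negative half-line is handled by time reversal, from the same embedding at `0`.
  obtain ⟨E₂, hE₂, hE₂0, hE₂H⟩ := hray (fun t => B (-t)) (hB.comp continuous_neg)
    (fun t => hS (-t)) F.toContinuousLinearMap F.norm_map (by simpa using hFB)
  have key : ∀ t, ‖if 0 ≤ t then E₁ t else E₂ (-t)‖ ≤ 1 ∧
      ∀ w, c' * ‖w‖ ≤ ‖B t ((if 0 ≤ t then E₁ t else E₂ (-t)) w)‖ := by
    intro t
    split_ifs with ht
    · exact hE₁H t ht
    · simpa using hE₂H (-t) (by linarith)
  exact ⟨fun t => if 0 ≤ t then E₁ t else E₂ (-t),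
    hE₁.if_le (hE₂.comp continuous_neg) continuous_const continuous_id
      fun t ht => by rw [← show (0 : ℝ) = t from ht, hE₁0, neg_zero, hE₂0],
    fun t => (key t).1, fun t => (key t).2⟩

/-! ### Matrices as operators, and continuous left inverses -/

/-- A matrix as a continuous linear map between Euclidean spaces. -/
noncomputable def matrixCLM (k l : ℕ) : Matrix (Fin k) (Fin l) ℝ ≃ₗ[ℝ]
    (EuclideanSpace ℝ (Fin l) →L[ℝ] EuclideanSpace ℝ (Fin k)) :=
  Matrix.toEuclideanLin ≪≫ₗ LinearMap.toContinuousLinearMap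

theorem matrixCLM_apply {k l : ℕ} (X : Matrix (Fin k) (Fin l) ℝ) (v : EuclideanSpace ℝ (Fin l)) :
    matrixCLM k l X v = WithLp.toLp 2 (X.mulVec v.ofLp) := rfl

theorem matrixCLM_single {k l : ℕ} (X : Matrix (Fin k) (Fin l) ℝ) (i : Fin l) :
    matrixCLM k l X (EuclideanSpace.single i 1) = euclideanColumn X i := rfl

theorem norm_matrixCLM {k l : ℕ} (X : Matrix (Fin k) (Fin l) ℝ) : ‖matrixCLM k l X‖ = ‖X‖ :=
  (Matrix.l2_opNorm_def X).symm

theorem matrixCLM_mul {j k l : ℕ} (X : Matrix (Fin j) (Fin k) ℝ) (Y : Matrix (Fin k) (Fin l) ℝ)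
    (v : EuclideanSpace ℝ (Fin l)) :
    matrixCLM j l (X * Y) v = matrixCLM j k X (matrixCLM k l Y v) := by
  simp [matrixCLM_apply, Matrix.mulVec_mulVec]

theorem continuous_matrixCLM (k l : ℕ) : Continuous (matrixCLM k l) :=
  (matrixCLM k l).toLinearMap.continuous_of_finiteDimensional

theorem continuous_matrixCLM_symm (k l : ℕ) : Continuous (matrixCLM k l).symm :=
  (matrixCLM k l).symm.toLinearMap.continuous_of_finiteDimensional

theorem inner_matrixCLM_transpose {k l : ℕ} (X : Matrix (Fin k) (Fin l) ℝ)
    (v : EuclideanSpace ℝ (Fin l)) (w : EuclideanSpace ℝ (Fin k)) :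
    inner ℝ v (matrixCLM l k X.transpose w) = inner ℝ (matrixCLM k l X v) w := by
  simp only [EuclideanSpace.inner_eq_star_dotProduct, matrixCLM_apply, star_trivial]
  rw [Matrix.mulVec_transpose, Matrix.dotProduct_mulVec]

theorem norm_euclideanColumn_le {k l : ℕ} (X : Matrix (Fin k) (Fin l) ℝ) (i : Fin l) :
    ‖euclideanColumn X i‖ ≤ ‖X‖ := by
  have := (matrixCLM k l X).le_opNorm (EuclideanSpace.single i 1)
  rwa [norm_matrixCLM, PiLp.norm_single, norm_one, mul_one, matrixCLM_single] at this

theorem matrixCLM_eq_sum {k l : ℕ} (X : Matrix (Fin k) (Fin l) ℝ) (v : EuclideanSpace ℝ (Fin l)) :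
    matrixCLM k l X v = ∑ j, v j • euclideanColumn X j := by
  ext i
  simp [matrixCLM_apply, Matrix.mulVec, dotProduct, euclideanColumn_apply, mul_comm]

/-- A continuous family of matrices that is bounded below has a continuous family of left inverses,
given by the Moore-Penrose formula. -/
theorem exists_continuous_left_inverse {n m : ℕ} {X : ℝ → Matrix (Fin n) (Fin m) ℝ}
    (hX : Continuous X) {κ : ℝ} (hκ : 0 < κ) (hXκ : ∀ t w, κ * ‖w‖ ≤ ‖matrixCLM n m (X t) w‖) :
    ∃ L : ℝ → Matrix (Fin m) (Fin n) ℝ, Continuous L ∧ (∀ t, L t * X t = 1) ∧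
      ∀ t, ‖L t‖ ≤ κ⁻¹ := by
  have hGram : ∀ t w, inner ℝ w (matrixCLM m m ((X t).transpose * X t) w) =
      ‖matrixCLM n m (X t) w‖ ^ 2 := by
    intro t w
    rw [matrixCLM_mul, inner_matrixCLM_transpose, real_inner_self_eq_norm_sq]
  have hdet : ∀ t, ((X t).transpose * X t).det ≠ 0 := by
    intro t h0
    obtain ⟨w, hw, hw0⟩ := Matrix.exists_mulVec_eq_zero_iff.2 h0
    have h1 := hGram t (WithLp.toLp 2 w)
    rw [matrixCLM_apply, hw0, WithLp.toLp_zero, inner_zero_right, eq_comm,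
      pow_eq_zero_iff two_ne_zero] at h1
    have h2 := hXκ t (WithLp.toLp 2 w)
    rw [h1] at h2
    have h3 : ‖(WithLp.toLp 2 w : EuclideanSpace ℝ (Fin m))‖ = 0 :=
      le_antisymm (by nlinarith) (norm_nonneg _)
    exact hw (by simpa using h3)
  refine ⟨fun t => ((X t).transpose * X t)⁻¹ * (X t).transpose, ?_, fun t => ?_, fun t => ?_⟩
  · have h1 : Continuous fun t => (X t).transpose * X t := hX.matrix_transpose.matrix_mul hX
    have h2 : Continuous fun t => ((X t).transpose * X t)⁻¹ := by
      simp only [Matrix.inv_def, Ring.inverse_eq_inv']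
      exact (h1.matrix_det.inv₀ hdet).smul h1.matrix_adjugate
    exact h2.matrix_mul hX.matrix_transpose
  · rw [Matrix.mul_assoc]
    exact Matrix.nonsing_inv_mul _ (isUnit_iff_ne_zero.2 (hdet t))
  · rw [← norm_matrixCLM]
    refine ContinuousLinearMap.opNorm_le_bound _ (inv_nonneg.2 hκ.le) fun v => ?_
    set w := matrixCLM m n (((X t).transpose * X t)⁻¹ * (X t).transpose) v with hw
    have h1 : matrixCLM m m ((X t).transpose * X t) w = matrixCLM m n (X t).transpose v := by
      rw [hw, ← matrixCLM_mul, ← Matrix.mul_assoc,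
        Matrix.mul_nonsing_inv _ (isUnit_iff_ne_zero.2 (hdet t)), Matrix.one_mul]
    -- The normal equations make `v ↦ X w` a contraction; the lower bound on `X` then bounds `w`.
    have h2 : ‖matrixCLM n m (X t) w‖ ^ 2 ≤ ‖matrixCLM n m (X t) w‖ * ‖v‖ := by
      rw [← hGram, h1, inner_matrixCLM_transpose]
      exact real_inner_le_norm _ _
    have h3 : ‖matrixCLM n m (X t) w‖ ≤ ‖v‖ := by
      rcases (norm_nonneg (matrixCLM n m (X t) w)).eq_or_lt with h0 | hpos
      · rw [← h0]; exact norm_nonneg v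
      · exact le_of_mul_le_mul_left (by rwa [← sq]) hpos
    rw [le_inv_mul_iff₀ hκ]
    exact (hXκ t w).trans h3

/-- The vectors supported in `σ` form a space of dimension `σ.card` on which a lower bound for the
columns in `σ` is a lower bound for the matrix. -/
theorem exists_submodule_of_column_lowerBound {n : ℕ} {B : Matrix (Fin n) (Fin n) ℝ} {c : ℝ}
    {σ : Finset (Fin n)} (hσ : ∀ a : Fin n → ℝ,
      c * Real.sqrt (∑ j ∈ σ, |a j| ^ 2) ≤ ‖∑ j ∈ σ, a j • euclideanColumn B j‖) :
    ∃ S : Submodule ℝ (EuclideanSpace ℝ (Fin n)), Module.finrank ℝ S = σ.card ∧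
      ∀ v ∈ S, c * ‖v‖ ≤ ‖matrixCLM n n B v‖ := by
  have hli : LinearIndependent ℝ fun j : σ => EuclideanSpace.single (j : Fin n) (1 : ℝ) :=
    ((EuclideanSpace.orthonormal_single (𝕜 := ℝ) (ι := Fin n)).comp _
      Subtype.val_injective).linearIndependent
  refine ⟨Submodule.span ℝ (Set.range fun j : σ => EuclideanSpace.single (j : Fin n) (1 : ℝ)),
    by rw [finrank_span_eq_card hli, Fintype.card_coe], fun v hv => ?_⟩
  have h0 : ∀ j ∉ σ, v j = 0 := by
    induction hv using Submodule.span_induction with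
    | mem v hv =>
      obtain ⟨i, rfl⟩ := hv
      intro j hj
      have : j ≠ i := fun h => hj (h ▸ i.2)
      simp [this]
    | zero => simp
    | add v w _ _ hv hw => intro j hj; simp [hv j hj, hw j hj]
    | smul a v _ hv => intro j hj; simp [hv j hj]
  have h1 := hσ v
  rwa [Finset.sum_subset (Finset.subset_univ σ) fun j _ hj => by simp [h0 j hj],
    Finset.sum_subset (Finset.subset_univ σ) fun j _ hj => by simp [h0 j hj],
    ← matrixCLM_eq_sum, ← show ‖v‖ = √(∑ j, |v j| ^ 2) from EuclideanSpace.norm_eq v] at h1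

/-- A contraction `E t` along which the column-normalized matrices are bounded below yields a
continuous factorization of the identity. -/
theorem exists_factorization_of_lowerBound {n m : ℕ} {A D : ℝ → Matrix (Fin n) (Fin n) ℝ}
    (hA : Continuous A) (hD : Continuous D) {δ κ : ℝ} (hDδ : ∀ t, ‖D t‖ ≤ δ) (hκ : 0 < κ)
    {E : ℝ → EuclideanSpace ℝ (Fin m) →L[ℝ] EuclideanSpace ℝ (Fin n)} (hE : Continuous E)
    (hE1 : ∀ t, ‖E t‖ ≤ 1) (hEκ : ∀ t w, κ * ‖w‖ ≤ ‖matrixCLM n n (A t * D t) (E t w)‖) :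
    ∃ (L : ℝ → Matrix (Fin m) (Fin n) ℝ) (R : ℝ → Matrix (Fin n) (Fin m) ℝ),
      Continuous L ∧ Continuous R ∧ (∀ t, L t * A t * R t = 1) ∧ ∀ t, ‖L t‖ * ‖R t‖ ≤ κ⁻¹ * δ := by
  let Y : ℝ → Matrix (Fin n) (Fin m) ℝ := fun t => (matrixCLM n m).symm (E t)
  have hYE : ∀ t, matrixCLM n m (Y t) = E t := fun t => (matrixCLM n m).apply_symm_apply (E t)
  have hY : Continuous Y := (continuous_matrixCLM_symm n m).comp hE
  have hR : Continuous fun t => D t * Y t := hD.matrix_mul hY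
  obtain ⟨L, hL, hL1, hLκ⟩ := exists_continuous_left_inverse (hA.matrix_mul hR) hκ fun t w => by
    rw [← Matrix.mul_assoc, matrixCLM_mul, hYE]
    exact hEκ t w
  refine ⟨L, fun t => D t * Y t, hL, hR, fun t => by rw [Matrix.mul_assoc]; exact hL1 t, fun t => ?_⟩
  refine mul_le_mul (hLκ t) ?_ (norm_nonneg _) (inv_nonneg.2 hκ.le)
  calc ‖D t * Y t‖ ≤ ‖D t‖ * ‖Y t‖ := Matrix.l2_opNorm_mul _ _
    _ ≤ δ * 1 := mul_le_mul (hDδ t) (by rw [← norm_matrixCLM, hYE]; exact hE1 t) (norm_nonneg _)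
        ((norm_nonneg _).trans (hDδ t))
    _ = δ := mul_one δ

/-! ### The continuous factorization -/

theorem exists_continuous_factorization {c₀ d₀ : ℝ} (h : IsRestrictedInvertibilityPair c₀ d₀)
    {n : ℕ} {A : ℝ → Matrix (Fin n) (Fin n) ℝ} {θ : ℝ} (hA : Continuous A) (hθ : 0 < θ)
    (hcol : ∀ t i, θ ≤ ‖euclideanColumn (A t) i‖) (hnorm : ∀ t, ‖A t‖ ≤ 1) {γ : ℝ} (hγ : 0 < γ)
    (hγ1 : γ < 1) {m : ℕ} (hm : m ≤ ⌈d₀ / 7 * n * θ ^ 2⌉₊) :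
    ∃ (L : ℝ → Matrix (Fin m) (Fin n) ℝ) (R : ℝ → Matrix (Fin n) (Fin m) ℝ),
      Continuous L ∧ Continuous R ∧ (∀ t, L t * A t * R t = 1) ∧
        ∀ t, ‖L t‖ * ‖R t‖ ≤ (γ * c₀)⁻¹ / θ := by
  obtain ⟨hc₀, hd₀, hpair⟩ := h
  have hκ : 0 < γ * c₀ := mul_pos hγ hc₀
  rcases Nat.eq_zero_or_pos m with rfl | hm0
  · refine ⟨fun _ => 0, fun _ => 0, continuous_const, continuous_const,
      fun t => Subsingleton.elim _ _, fun t => ?_⟩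
    rw [norm_zero, zero_mul]
    positivity
  have hn : 0 < n := by
    rcases Nat.eq_zero_or_pos n with rfl | hn
    · simp at hm; omega
    · exact hn
  let D : ℝ → Matrix (Fin n) (Fin n) ℝ := fun t =>
    Matrix.diagonal fun i => ‖euclideanColumn (A t) i‖⁻¹
  have hcolpos : ∀ t i, 0 < ‖euclideanColumn (A t) i‖ := fun t i => hθ.trans_le (hcol t i)
  have hD : Continuous D := by
    refine Continuous.matrix_diagonal (continuous_pi fun i => ?_)
    refine Continuous.inv₀ (Continuous.norm ?_) fun t => (hcolpos t i).ne'
    exact ((continuous_matrixCLM n n).comp hA).clm_apply continuous_const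
  have hDθ : ∀ t, ‖D t‖ ≤ θ⁻¹ := by
    intro t
    rw [Matrix.l2_opNorm_diagonal, pi_norm_le_iff_of_nonneg (inv_nonneg.2 hθ.le)]
    intro i
    rw [norm_inv, norm_norm]
    exact inv_anti₀ hθ (hcol t i)
  have hBcol : ∀ t i, ‖euclideanColumn (A t * D t) i‖ = 1 := by
    intro t i
    have : euclideanColumn (A t * D t) i =
        ‖euclideanColumn (A t) i‖⁻¹ • euclideanColumn (A t) i := by
      ext j
      simp [euclideanColumn_apply, D, mul_comm]
    rw [this, norm_smul, norm_inv, norm_norm, inv_mul_cancel₀ (hcolpos t i).ne']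
  have hσ : ∀ t, ∃ σ : Finset (Fin n), d₀ * n * θ ^ 2 ≤ σ.card ∧ ∀ a : Fin n → ℝ,
      c₀ * Real.sqrt (∑ j ∈ σ, |a j| ^ 2) ≤ ‖∑ j ∈ σ, a j • euclideanColumn (A t * D t) j‖ := by
    intro t
    obtain ⟨σ, hcard, hσ⟩ := hpair n (A t * D t) (hBcol t)
    refine ⟨σ, le_trans ?_ hcard, hσ⟩
    -- Positivity of this norm makes the division in the cardinality bound a genuine one.
    have h1 : 1 ≤ ‖A t * D t‖ := (hBcol t ⟨0, hn⟩) ▸ norm_euclideanColumn_le _ _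
    have h2 : ‖A t * D t‖ ≤ θ⁻¹ := by
      calc ‖A t * D t‖ ≤ ‖A t‖ * ‖D t‖ := Matrix.l2_opNorm_mul _ _
        _ ≤ 1 * θ⁻¹ := mul_le_mul (hnorm t) (hDθ t) (norm_nonneg _) zero_le_one
        _ = θ⁻¹ := one_mul _
    rw [le_div_iff₀ (by positivity)]
    have h3 : θ * ‖A t * D t‖ ≤ 1 := by
      rwa [← le_inv_mul_iff₀ hθ, mul_one]
    have h4 : (θ * ‖A t * D t‖) ^ 2 ≤ 1 := pow_le_one₀ (by positivity) h3
    calc d₀ * n * θ ^ 2 * ‖A t * D t‖ ^ 2 = d₀ * n * (θ * ‖A t * D t‖) ^ 2 := by ring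
      _ ≤ d₀ * n * 1 := mul_le_mul_of_nonneg_left h4 (by positivity)
      _ = d₀ * n := mul_one _
  suffices hE : ∃ E : ℝ → EuclideanSpace ℝ (Fin m) →L[ℝ] EuclideanSpace ℝ (Fin n), Continuous E ∧
      (∀ t, ‖E t‖ ≤ 1) ∧ ∀ t w, γ * c₀ * ‖w‖ ≤ ‖matrixCLM n n (A t * D t) (E t w)‖ by
    obtain ⟨E, hE, hE1, hEκ⟩ := hE
    simpa only [div_eq_mul_inv] using
      exists_factorization_of_lowerBound hA hD hDθ hκ hE hE1 hEκ
  have hγc : γ * c₀ < c₀ := mul_lt_of_lt_one_left hc₀ hγ1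
  -- The ceiling gives only `|σ| ≥ 7m - 6`, which is at least `3m` when `m ≥ 2`. For `m = 1` a fixed
  -- basis vector serves, as its image has norm `1 ≥ c₀`.
  rcases (show m = 1 ∨ 2 ≤ m by omega) with rfl | hm2
  · have hc₀1 : c₀ ≤ 1 := by
      obtain ⟨σ, hcard, hσ⟩ := hσ 0
      have h1 : (0 : ℝ) < σ.card := lt_of_lt_of_le (by positivity) hcard
      obtain ⟨j, hj⟩ := Finset.card_pos.1 (Nat.cast_pos.1 h1)
      have h2 := hσ fun i => if i = j then 1 else 0
      simpa [hj, hBcol, apply_ite] using h2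
    let E : EuclideanSpace ℝ (Fin 1) →L[ℝ] EuclideanSpace ℝ (Fin n) :=
      (EuclideanSpace.proj 0).smulRight (EuclideanSpace.single (⟨0, hn⟩ : Fin n) (1 : ℝ))
    have hw : ∀ w : EuclideanSpace ℝ (Fin 1), ‖w‖ = |w 0| := fun w => by
      simp [EuclideanSpace.norm_eq, Real.sqrt_sq_eq_abs]
    refine ⟨fun _ => E, continuous_const, fun _ => ?_, fun t w => ?_⟩
    · refine E.opNorm_le_bound zero_le_one fun w => ?_
      simp [E, norm_smul, hw]
    · simp only [E, ContinuousLinearMap.smulRight_apply, map_smul, matrixCLM_single, norm_smul,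
        hBcol, mul_one, hw]
      refine (mul_le_of_le_one_left (abs_nonneg _) (hγc.le.trans hc₀1)).trans_eq ?_
      simp
  · refine exists_continuous_forall_lowerBound
      ((continuous_matrixCLM n n).comp (hA.matrix_mul hD)) hκ.le hγc fun t => ?_
    obtain ⟨σ, hcard, hσ⟩ := hσ t
    obtain ⟨S, hS, hSB⟩ := exists_submodule_of_column_lowerBound hσ
    refine ⟨S, ?_, hSB⟩
    rw [hS, finrank_euclideanSpace, Fintype.card_fin]
    have h1 : ((m - 1 : ℕ) : ℝ) < d₀ / 7 * n * θ ^ 2 := Nat.lt_ceil.1 (by omega)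
    have h2 : ((7 * (m - 1) : ℕ) : ℝ) < σ.card := by
      push_cast
      linarith
    have h3 : 7 * (m - 1) < σ.card := by exact_mod_cast h2
    omega

/-! ### Optimality of the order of `m` -/

/-- The matrix whose columns are `θ e_{g j}` is a contraction if the fibers of `g` are small. -/
theorem norm_fiberMatrix_le_one {n : ℕ} {θ : ℝ} (g : Fin n → Fin n)
    (hg : ∀ i, θ ^ 2 * (Finset.univ.filter fun j => g j = i).card ≤ 1) :
    ‖(Matrix.of fun i j => if g j = i then θ else 0 : Matrix (Fin n) (Fin n) ℝ)‖ ≤ 1 := by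
  rw [← norm_matrixCLM]
  refine ContinuousLinearMap.opNorm_le_bound _ zero_le_one fun v => ?_
  rw [one_mul]
  refine le_of_sq_le_sq ?_ (norm_nonneg _)
  rw [EuclideanSpace.norm_sq_eq, EuclideanSpace.norm_sq_eq,
    ← Finset.sum_fiberwise Finset.univ g fun j => ‖v j‖ ^ 2]
  refine Finset.sum_le_sum fun i _ => ?_
  have h1 : matrixCLM n n (Matrix.of fun i j => if g j = i then θ else 0) v i =
      θ * ∑ j with g j = i, v j := by
    simp [matrixCLM_apply, Matrix.mulVec, dotProduct, Finset.sum_filter, Finset.mul_sum]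
  simp only [h1, Real.norm_eq_abs, sq_abs, mul_pow]
  have h2 := sq_sum_le_card_mul_sum_sq (s := Finset.univ.filter fun j => g j = i) (f := fun j => v j)
  have h3 : 0 ≤ ∑ j with g j = i, v j ^ 2 := Finset.sum_nonneg fun _ _ => sq_nonneg _
  calc θ ^ 2 * (∑ j with g j = i, v j) ^ 2
      ≤ θ ^ 2 * ((Finset.univ.filter fun j => g j = i).card * ∑ j with g j = i, v j ^ 2) :=
        mul_le_mul_of_nonneg_left h2 (sq_nonneg θ)
    _ = θ ^ 2 * (Finset.univ.filter fun j => g j = i).card * ∑ j with g j = i, v j ^ 2 := by ring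
    _ ≤ 1 * ∑ j with g j = i, v j ^ 2 := mul_le_mul_of_nonneg_right (hg i) h3
    _ = _ := one_mul _

theorem Matrix.card_le_of_mul_eq_one {K : Type*} [Field K] {m r : ℕ} {X : Matrix (Fin m) (Fin r) K}
    {Y : Matrix (Fin r) (Fin m) K} (h : X * Y = 1) : m ≤ r := by
  have h1 := Matrix.rank_mul_le_left X Y
  rw [h, Matrix.rank_one, Fintype.card_fin] at h1
  exact h1.trans (Matrix.rank_le_width X)

theorem exists_matrix_forall_factorization_lt {n : ℕ} {θ : ℝ} (hθ : 0 < θ) (hθ1 : θ ≤ 1)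
    (hn : 1 ≤ n * θ ^ 2) :
    ∃ A : Matrix (Fin n) (Fin n) ℝ, (∀ i, θ ≤ ‖euclideanColumn A i‖) ∧ ‖A‖ ≤ 1 ∧
      ∀ (m : ℕ) (L : Matrix (Fin m) (Fin n) ℝ) (R : Matrix (Fin n) (Fin m) ℝ),
        L * A * R = 1 → (m : ℝ) < 4 * n * θ ^ 2 := by
  have hθ2 : 0 < θ ^ 2 := by positivity
  set y : ℝ := 1 / θ ^ 2 with hy
  have hyθ : θ ^ 2 * y = 1 := by rw [hy]; field_simp
  have hy1 : 1 ≤ y := by rw [hy, one_le_div hθ2]; exact pow_le_one₀ hθ.le hθ1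
  set s := ⌊y⌋₊ with hs
  have hs1 : 1 ≤ s := (Nat.one_le_floor_iff y).2 hy1
  have hsy : (s : ℝ) ≤ y := Nat.floor_le (by linarith)
  have hys : y < 2 * s := by
    have h1 := Nat.lt_floor_add_one y
    have h2 : (1 : ℝ) ≤ s := by exact_mod_cast hs1
    linarith
  -- Blocks of `s = ⌊θ⁻²⌋` consecutive indices: small enough for a contraction, large enough for few
  -- distinct columns.
  let g : Fin n → Fin n := fun j => ⟨j / s, (Nat.div_le_self _ _).trans_lt j.2⟩
  refine ⟨Matrix.of fun i j => if g j = i then θ else 0, fun i => ?_,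
    norm_fiberMatrix_le_one g fun i => ?_, fun m L R hLR => ?_⟩
  · have : euclideanColumn (Matrix.of fun i j => if g j = i then θ else 0) i =
        EuclideanSpace.single (g i) θ := by
      ext j
      simp [euclideanColumn_apply, eq_comm]
    rw [this, PiLp.norm_single]
    exact le_abs_self θ
  · have hcard : (Finset.univ.filter fun j => g j = i).card ≤ s := by
      rw [← Finset.card_range s]
      refine Finset.card_le_card_of_injOn (fun j => (j : ℕ) % s)
        (fun j _ => Finset.mem_coe.2 (Finset.mem_range.2 (Nat.mod_lt _ hs1))) ?_
      intro j hj k hk hjk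
      have h1 : (j : ℕ) / s = k / s := by
        have hj' : g j = i := by simpa using hj
        have hk' : g k = i := by simpa using hk
        exact congrArg Fin.val (hj'.trans hk'.symm)
      ext
      rw [← Nat.div_add_mod (j : ℕ) s, ← Nat.div_add_mod (k : ℕ) s, h1]
      simpa using hjk
    rw [← hyθ]
    exact mul_le_mul_of_nonneg_left (le_trans (by exact_mod_cast hcard) hsy) hθ2.le
  -- Factoring through dimension `n / s + 1` bounds the rank. Since `n / s ≤ 2 n θ²` and `1 ≤ n θ²`,
  -- this gives `m ≤ 3 n θ²`.
  · have hfac : (Matrix.of fun i j => if g j = i then θ else 0 : Matrix (Fin n) (Fin n) ℝ) =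
        (Matrix.of fun i a => if (a : ℕ) = i then 1 else 0 : Matrix (Fin n) (Fin (n / s + 1)) ℝ) *
          (Matrix.of fun a j => if (j : ℕ) / s = a then θ else 0 :
            Matrix (Fin (n / s + 1)) (Fin n) ℝ) := by
      ext i j
      have hlt : (j : ℕ) / s < n / s + 1 :=
        Nat.lt_succ_of_le (Nat.div_le_div_right j.2.le)
      rw [Matrix.mul_apply, Finset.sum_eq_single ⟨(j : ℕ) / s, hlt⟩]
      · simp [g, Fin.ext_iff]
      · intro a _ ha
        have : (j : ℕ) / s ≠ a := fun h => ha (Fin.ext h.symm)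
        simp [this]
      · simp
    rw [hfac, ← Matrix.mul_assoc, Matrix.mul_assoc] at hLR
    have hm : (m : ℝ) ≤ (n / s + 1 : ℕ) := by exact_mod_cast Matrix.card_le_of_mul_eq_one hLR
    have hdiv : ((n / s : ℕ) : ℝ) ≤ n / s := Nat.cast_div_le
    have hs0 : (0 : ℝ) < s := by exact_mod_cast hs1
    have hle : (n : ℝ) / s ≤ 2 * (n * θ ^ 2) := by
      rw [div_le_iff₀ hs0]
      have h1 : 1 ≤ θ ^ 2 * (2 * s) := by
        rw [← hyθ]; exact mul_le_mul_of_nonneg_left hys.le hθ2.le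
      nlinarith [(Nat.cast_nonneg n : (0 : ℝ) ≤ n)]
    push_cast at hm
    linarith

theorem theorem3p10 :
    -- admissible constants exist
    (∃ c₀ d₀ : ℝ, IsRestrictedInvertibilityPair c₀ d₀) ∧
    -- continuous factorization of the identity, for every admissible pair of constants
    (∀ c₀ d₀ : ℝ, IsRestrictedInvertibilityPair c₀ d₀ →
      ∀ (n : ℕ) (A : ℝ → Matrix (Fin n) (Fin n) ℝ) (θ : ℝ),
        Continuous A → 0 < θ → (∀ t i, θ ≤ ‖euclideanColumn (A t) i‖) → (∀ t, ‖A t‖ ≤ 1) →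
        ∀ γ : ℝ, 0 < γ → γ < 1 → ∀ m : ℕ, m ≤ ⌈d₀ / 7 * n * θ ^ 2⌉₊ →
          ∃ (L : ℝ → Matrix (Fin m) (Fin n) ℝ) (R : ℝ → Matrix (Fin n) (Fin m) ℝ),
            Continuous L ∧ Continuous R ∧
              (∀ t, L t * A t * R t = 1) ∧ (∀ t, ‖L t‖ * ‖R t‖ ≤ (γ * c₀)⁻¹ / θ)) ∧
    -- the order `n θ²` of `m` is optimal, whatever norms are allowed for `L` and `R`
    (∀ (n : ℕ) (θ : ℝ), 0 < θ → θ ≤ 1 → 1 ≤ n * θ ^ 2 →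
      ∃ A : ℝ → Matrix (Fin n) (Fin n) ℝ,
        Continuous A ∧ (∀ t i, θ ≤ ‖euclideanColumn (A t) i‖) ∧ (∀ t, ‖A t‖ ≤ 1) ∧
          ∀ (t : ℝ) (m : ℕ) (L : Matrix (Fin m) (Fin n) ℝ) (R : Matrix (Fin n) (Fin m) ℝ),
            L * A t * R = 1 → (m : ℝ) < 4 * n * θ ^ 2) := by
  refine ⟨exists_isRestrictedInvertibilityPair, ?_, ?_⟩
  · intro c₀ d₀ h n A θ hA hθ hcol hnorm γ hγ hγ1 m hm
    exact exists_continuous_factorization h hA hθ hcol hnorm hγ hγ1 hm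
  · intro n θ hθ hθ1 hn
    obtain ⟨A, hcol, hnorm, hA⟩ := exists_matrix_forall_factorization_lt hθ hθ1 hn
    exact ⟨fun _ => A, continuous_const, fun _ => hcol, fun _ => hnorm, fun _ => hA⟩
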